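/- Let $m_2<m_1$ be nonnegative integers and put $n=m_1+m_2+1$. Let $h\in C^{n+1}(0,\infty)$ be real-valued with $h^{(n+1)}(x)\neq 0$ for all $x>0$. For $a,b>0$ with $a\ne b$, let $P_h,Q_h$ be the polynomials of degree at most $n$ determined by $$P_h^{(j)}(a)=h^{(j)}(a)\ (0\le j\le m_1),\qquad P_h^{(j)}(b)=h^{(j)}(b)\ (0\le j\le m_2),$$ $$Q_h^{(j)}(a)=h^{(j)}(a)\ (0\le j\le m_2),\qquad Q_h^{(j)}(b)=h^{(j)}(b)\ (0\le j\le m_1),$$ and let $M_{h,m_1,m_2}(a,b)$ be the unique point $x$ strictly between $a$ and $b$ such that $P_h(x)=Q_h(x)$ if $m_1-m_2$ is even, respectively $h(x)=\tfrac12\left(P_h(x)+Q_h(x)\right)$ if $m_1-m_2$ is odd. Theorem. Let $f,g\in C^{n+1}(0,\infty)$ be real-valued functions such that $f^{(n+1)}$ and $g^{(n+1)}$ have no zero on $(0,\infty)$, and suppose that $\phi=f^{(n+1)}/g^{(n+1)}$ is strictly monotone (strictly increasing or strictly decreasing) on $(0,\infty)$. Then $M_{f,m_1,m_2}(a,b)$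 and $M_{g,m_1,m_2}(a,b)$ are well defined (the point $x$ above exists and is unique) for all $a,b>0$ with $a\neq b$, and the two means are strictly comparable: either $M_{f,m_1,m_2}(a,b)<M_{g,m_1,m_2}(a,b)$ for all $a,b>0$ with $a\neq b$, or $M_{f,m_1,m_2}(a,b)>M_{g,m_1,m_2}(a,b)$ for all $a,b>0$ with $a\neq b$. -/

import Mathlib

open Polynomial

/-- `P` is the Hermite interpolant of `f` to order `k` at `a` and to order `l` at `b`: a
polynomial of degree at most `k + l + 1` with `P^(j)(a) = f^(j)(a)` for `j = 0, …, k` and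
`P^(j)(b) = f^(j)(b)` for `j = 0, …, l`. -/
def IsHermiteInterpolant (f : ℝ → ℝ) (a b : ℝ) (k l : ℕ) (P : ℝ[X]) : Prop :=
  P.degree ≤ ((k + l + 1 : ℕ) : WithBot ℕ) ∧
  (∀ j ≤ k, (derivative^[j] P).eval a = iteratedDeriv j f a) ∧
  (∀ j ≤ l, (derivative^[j] P).eval b = iteratedDeriv j f b)

/-- `x` lies strictly between `a` and `b` and, with `P` and `Q` the Hermite interpolants of `f` of
orders `m₁, m₂` and `m₂, m₁` at `a, b`, one has `P(x) = Q(x)` when `m₁ - m₂` is even, and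
`f(x) = (P(x) + Q(x)) / 2` when `m₁ - m₂` is odd. -/
def IsHermiteMeanPoint (f : ℝ → ℝ) (m₁ m₂ : ℕ) (a b x : ℝ) : Prop :=
  x ∈ Set.uIoo a b ∧
  ∃ P Q : ℝ[X], IsHermiteInterpolant f a b m₁ m₂ P ∧ IsHermiteInterpolant f a b m₂ m₁ Q ∧
    if Even (m₁ - m₂) then P.eval x = Q.eval x else f x = (P.eval x + Q.eval x) / 2

open Classical in
/-- The mean `M_{f,m₁,m₂}(a,b)`: the unique point given by `IsHermiteMeanPoint`. For `a = b` there
is no point strictly between `a` and `b`, and the value is `a`. -/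
noncomputable def hermiteMean (f : ℝ → ℝ) (m₁ m₂ : ℕ) (a b : ℝ) : ℝ :=
  if h : ∃! x, IsHermiteMeanPoint f m₁ m₂ a b x then h.choose else a

/-! Put `d = m₁ - m₂`. Subtracting the value at a node `c` and dividing by `t - c` turns `h` into
its slope function, whose `j`-th derivative is `∫₀¹ u ^ j * h^(j+1) (c + u * (t - c)) du`. Doing
this `m₂ + 1` times at each of `a` and `b` leaves a function `k`, and the interpolation errors
become `h - P = w * (k - S)` and `h - Q = w * (k - T)`, where `w = ((x - a) * (x - b)) ^ (m₂ + 1)`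
and `S`, `T` are the Taylor polynomials of `k` of degree less than `d` at `a` and `b`. For either
parity of `d`, the equation of the mean is `(k - S) - (-1) ^ d * (k - T) = 0`.

The sign of `h` may be normalised so that its top derivative is positive. The integral formula then
gives `k^(d) > 0`, so for `a < b` the left side is strictly increasing on `[a, b]`, negative at `a`
and positive at `b`: the mean exists and is unique.

For two functions, strict monotonicity of the ratio of top derivatives also survives each slope
operation (`slopeJet_cross_lt`), because a weighted average of a function with increasing ratio has
increasing ratio. Let `k` and `l` be what remains of `f` and `g`, and suppose `k^(d) / l^(d)`
increases. At the mean `x` of `g`, compare `k` with `λ * l`, where `λ = k^(d)(x) / l^(d)(x)`: the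
top derivative of the difference changes sign exactly at `x`. Hence the equation for `f` has a
negative left side at `x`, and the mean of `f` lies to the right of `x`. -/

/-! ### Calculus of slope functions. -/

/-- `H 0, H 1, …, H N` are a function on `(0, ∞)` and its successive derivatives, the last of them
continuous. -/
def IsJet (N : ℕ) (H : ℕ → ℝ → ℝ) : Prop :=
  (∀ j < N, ∀ x : ℝ, 0 < x → HasDerivAt (H j) (H (j + 1) x) x) ∧ ContinuousOn (H N) (Set.Ioi 0)

/-- The derivatives of the slope function `t ↦ (h t - h c) / (t - c)`, in integral form. -/
noncomputable def slopeJet (c : ℝ) (H : ℕ → ℝ → ℝ) (j : ℕ) (t : ℝ) : ℝ :=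
  ∫ u in (0 : ℝ)..1, u ^ j * H (j + 1) (c + u * (t - c))

theorem IsJet.continuousOn {N : ℕ} {H : ℕ → ℝ → ℝ} (h : IsJet N H) {j : ℕ} (hj : j ≤ N) :
    ContinuousOn (H j) (Set.Ioi 0) := by
  rcases hj.lt_or_eq with h1 | rfl
  · exact fun x hx => (h.1 j h1 x hx).continuousAt.continuousWithinAt
  · exact h.2

theorem segment_mem_Icc {α β c t u : ℝ} (hc : c ∈ Set.Icc α β) (ht : t ∈ Set.Icc α β)
    (hu : u ∈ Set.Icc (0 : ℝ) 1) : c + u * (t - c) ∈ Set.Icc α β := by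
  obtain ⟨h1, h2⟩ := hc
  obtain ⟨h3, h4⟩ := ht
  obtain ⟨h5, h6⟩ := hu
  constructor <;> nlinarith

theorem segment_pos {c t u : ℝ} (hc : 0 < c) (ht : 0 < t) (hu : u ∈ Set.Icc (0 : ℝ) 1) :
    0 < c + u * (t - c) :=
  lt_of_lt_of_le (lt_min hc ht)
    (segment_mem_Icc (β := max c t) ⟨min_le_left _ _, le_max_left _ _⟩
      ⟨min_le_right _ _, le_max_right _ _⟩ hu).1

theorem continuousOn_pow_mul_comp_segment {y : ℝ → ℝ} (hy : ContinuousOn y (Set.Ioi 0)) (j : ℕ)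
    {c t : ℝ} (hc : 0 < c) (ht : 0 < t) :
    ContinuousOn (fun u : ℝ => u ^ j * y (c + u * (t - c))) (Set.Icc 0 1) := by
  refine ContinuousOn.mul (by fun_prop) ?_
  exact hy.comp (by fun_prop) fun u hu => segment_pos hc ht hu

theorem exists_bound_near {y : ℝ → ℝ} (hy : ContinuousOn y (Set.Ioi 0)) {c t : ℝ} (hc : 0 < c)
    (ht : 0 < t) : ∃ s ∈ nhds t, (∀ x ∈ s, 0 < x) ∧ ∃ C : ℝ, ∀ x ∈ s, ∀ u ∈ Set.Icc (0 : ℝ) 1,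
      |y (c + u * (x - c))| ≤ C := by
  -- `[α, β]` is a compact part of `(0, ∞)` containing every segment from `c` to a point near `t`;
  -- the bound on it feeds dominated convergence.
  set α := min c (t / 2) with hα
  set β := max c (t + 1) with hβ
  have hα0 : 0 < α := lt_min hc (by linarith)
  obtain ⟨C, hC⟩ := isCompact_Icc.exists_bound_of_continuousOn
    (hy.mono (fun x (hx : x ∈ Set.Icc α β) => lt_of_lt_of_le hα0 hx.1))
  refine ⟨Set.Ioo (t / 2) (t + 1), Ioo_mem_nhds (by linarith) (by linarith), ?_, C, ?_⟩
  · intro x hx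
    linarith [hx.1]
  · intro x hx u hu
    refine hC _ (segment_mem_Icc ⟨min_le_left _ _, le_max_left _ _⟩ ⟨?_, ?_⟩ hu)
    · exact (min_le_right _ _).trans hx.1.le
    · exact hx.2.le.trans (le_max_right _ _)

theorem continuousOn_integral_segment {y : ℝ → ℝ} (hy : ContinuousOn y (Set.Ioi 0)) (j : ℕ)
    {c : ℝ} (hc : 0 < c) :
    ContinuousOn (fun t => ∫ u in (0 : ℝ)..1, u ^ j * y (c + u * (t - c))) (Set.Ioi 0) := by
  intro t ht
  obtain ⟨s, hs, hpos, C, hC⟩ := exists_bound_near hy hc ht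
  refine ContinuousAt.continuousWithinAt ?_
  refine intervalIntegral.continuousAt_of_dominated_interval (bound := fun _ => C) ?_ ?_
    intervalIntegrable_const ?_
  · filter_upwards [hs] with x hx
    rw [Set.uIoc_of_le zero_le_one]
    exact ((continuousOn_pow_mul_comp_segment hy j hc (hpos x hx)).mono
      Set.Ioc_subset_Icc_self).aestronglyMeasurable measurableSet_Ioc
  · filter_upwards [hs] with x hx
    refine Filter.Eventually.of_forall fun u hu => ?_
    rw [Set.uIoc_of_le zero_le_one] at hu
    have hu' := Set.Ioc_subset_Icc_self hu
    have h1 := hC x hx u hu'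
    rw [Real.norm_eq_abs, abs_mul, abs_of_nonneg (pow_nonneg hu'.1 j)]
    exact (mul_le_of_le_one_left (abs_nonneg _) (pow_le_one₀ hu'.1 hu'.2)).trans h1
  · refine Filter.Eventually.of_forall fun u hu => ?_
    rw [Set.uIoc_of_le zero_le_one] at hu
    have h1 : ContinuousAt y (c + u * (t - c)) :=
      hy.continuousAt (Ioi_mem_nhds (segment_pos hc ht (Set.Ioc_subset_Icc_self hu)))
    exact continuousAt_const.mul
      (ContinuousAt.comp (f := fun x : ℝ => c + u * (x - c)) h1 (by fun_prop))

theorem hasDerivAt_integral_segment {y y' : ℝ → ℝ}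
    (hy : ∀ x : ℝ, 0 < x → HasDerivAt y (y' x) x) (hy' : ContinuousOn y' (Set.Ioi 0)) (j : ℕ)
    {c t : ℝ} (hc : 0 < c) (ht : 0 < t) :
    HasDerivAt (fun t => ∫ u in (0 : ℝ)..1, u ^ j * y (c + u * (t - c)))
      (∫ u in (0 : ℝ)..1, u ^ (j + 1) * y' (c + u * (t - c))) t := by
  have hyc : ContinuousOn y (Set.Ioi 0) :=
    fun x hx => (hy x hx).continuousAt.continuousWithinAt
  obtain ⟨s, hs, hpos, C, hC⟩ := exists_bound_near hy' hc ht
  refine (intervalIntegral.hasDerivAt_integral_of_dominated_loc_of_deriv_le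
    (F := fun x u => u ^ j * y (c + u * (x - c)))
    (F' := fun x u => u ^ (j + 1) * y' (c + u * (x - c))) (bound := fun _ => C) hs ?_ ?_ ?_ ?_
    intervalIntegrable_const ?_).2
  · filter_upwards [hs] with x hx
    rw [Set.uIoc_of_le zero_le_one]
    exact ((continuousOn_pow_mul_comp_segment hyc j hc (hpos x hx)).mono
      Set.Ioc_subset_Icc_self).aestronglyMeasurable measurableSet_Ioc
  · exact (continuousOn_pow_mul_comp_segment hyc j hc ht).intervalIntegrable_of_Icc zero_le_one
  · rw [Set.uIoc_of_le zero_le_one]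
    exact ((continuousOn_pow_mul_comp_segment hy' (j + 1) hc ht).mono
      Set.Ioc_subset_Icc_self).aestronglyMeasurable measurableSet_Ioc
  · refine Filter.Eventually.of_forall fun u hu x hx => ?_
    rw [Set.uIoc_of_le zero_le_one] at hu
    have hu' := Set.Ioc_subset_Icc_self hu
    have h1 := hC x hx u hu'
    rw [Real.norm_eq_abs, abs_mul, abs_of_nonneg (pow_nonneg hu'.1 _)]
    exact (mul_le_of_le_one_left (abs_nonneg _) (pow_le_one₀ hu'.1 hu'.2)).trans h1
  · refine Filter.Eventually.of_forall fun u hu x hx => ?_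
    rw [Set.uIoc_of_le zero_le_one] at hu
    have h1 := hy _ (segment_pos hc (hpos x hx) (Set.Ioc_subset_Icc_self hu))
    have h2 : HasDerivAt (fun x : ℝ => c + u * (x - c)) u x := by
      simpa using (((hasDerivAt_id x).sub_const c).const_mul u).const_add c
    have h3 := (h1.comp x h2).const_mul (u ^ j)
    refine h3.congr_deriv ?_
    ring

theorem isJet_slopeJet {N : ℕ} {H : ℕ → ℝ → ℝ} (h : IsJet (N + 1) H) {c : ℝ} (hc : 0 < c) :
    IsJet N (slopeJet c H) :=
  ⟨fun j hj _ hx => hasDerivAt_integral_segment (h.1 (j + 1) (by omega))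
      (h.continuousOn (j := j + 2) (by omega)) j hc hx,
    continuousOn_integral_segment h.2 N hc⟩

theorem IsJet.eq_add_slopeJet {N : ℕ} {H : ℕ → ℝ → ℝ} (h : IsJet (N + 1) H) {c t : ℝ}
    (hc : 0 < c) (ht : 0 < t) : H 0 t = H 0 c + (t - c) * slopeJet c H 0 t := by
  have h1 : ∀ u ∈ Set.uIcc (0 : ℝ) 1,
      HasDerivAt (fun u => H 0 (c + u * (t - c))) (H 1 (c + u * (t - c)) * (t - c)) u := by
    intro u hu
    rw [Set.uIcc_of_le zero_le_one] at hu
    have h2 := h.1 0 (by omega) _ (segment_pos hc ht hu)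
    have h3 : HasDerivAt (fun u : ℝ => c + u * (t - c)) (t - c) u := by
      simpa using ((hasDerivAt_id u).mul_const (t - c)).const_add c
    exact h2.comp u h3
  have h2 : ContinuousOn (fun u : ℝ => H 1 (c + u * (t - c)) * (t - c)) (Set.Icc 0 1) := by
    have := continuousOn_pow_mul_comp_segment (h.continuousOn (j := 1) (by omega)) 0 hc ht
    simp only [pow_zero, one_mul] at this
    exact this.mul continuousOn_const
  have h3 := intervalIntegral.integral_eq_sub_of_hasDerivAt h1
    (h2.intervalIntegrable_of_Icc zero_le_one)
  rw [intervalIntegral.integral_mul_const] at h3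
  simp only [one_mul, zero_mul, add_zero, add_sub_cancel] at h3
  simp only [slopeJet, pow_zero, one_mul, zero_add]
  linarith

/-- Leibniz rule for `h t = h c + (t - c) * s t`. At `t = c` the term with the higher derivative of
`s` drops out, which is where the extra order of contact comes from. -/
theorem IsJet.succ_eq_slopeJet {N : ℕ} {H : ℕ → ℝ → ℝ} (h : IsJet (N + 1) H) {c : ℝ}
    (hc : 0 < c) (j : ℕ) (hj : j < N) : ∀ t : ℝ, 0 < t →
      H (j + 1) t = (t - c) * slopeJet c H (j + 1) t + (j + 1) * slopeJet c H j t := by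
  have hS := isJet_slopeJet h hc
  induction j with
  | zero =>
    intro t ht
    have h1 := h.1 0 (by omega) t ht
    have h2 := ((((hasDerivAt_id t).sub_const c).mul (hS.1 0 hj t ht)).const_add (H 0 c))
    have h3 := h2.congr_of_eventuallyEq (f₁ := H 0) <| by
      filter_upwards [Ioi_mem_nhds ht] with x hx
      exact h.eq_add_slopeJet hc hx
    rw [h1.unique h3]
    simp only [id]
    push_cast
    ring
  | succ j ih =>
    intro t ht
    have h1 := h.1 (j + 1) (by omega) t ht
    have h2 := (((hasDerivAt_id t).sub_const c).mul (hS.1 (j + 1) hj t ht)).add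
      ((hS.1 j (by omega) t ht).const_mul ((j : ℝ) + 1))
    have h3 := h2.congr_of_eventuallyEq (f₁ := H (j + 1)) <| by
      filter_upwards [Ioi_mem_nhds ht] with x hx
      exact ih (by omega) x hx
    rw [h1.unique h3]
    simp only [id]
    push_cast
    ring

/-! ### Positivity and monotone ratios pass to slope functions. -/

theorem slopeJet_pos {N : ℕ} {H : ℕ → ℝ → ℝ} (h : IsJet (N + 1) H)
    (hpos : ∀ x : ℝ, 0 < x → 0 < H (N + 1) x) {c t : ℝ} (hc : 0 < c) (ht : 0 < t) :
    0 < slopeJet c H N t := by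
  refine intervalIntegral.intervalIntegral_pos_of_pos_on
    ((continuousOn_pow_mul_comp_segment h.2 N hc ht).intervalIntegrable_of_Icc zero_le_one)
    (fun u hu => ?_) zero_lt_one
  exact mul_pos (pow_pos hu.1 _) (hpos _ (segment_pos hc ht (Set.Ioo_subset_Icc_self hu)))

/-- A mediant argument. Rescaling shows that the integral at `t` is a multiple of the integral at
`s` plus a contribution from arguments in `[s, t]`. The first part has ratio at most `p s / q s`,
the second has a larger one. The hypothesis is cross-multiplied, so no quotient is needed. -/
theorem integral_pow_mul_cross_lt {p q : ℝ → ℝ} {t : ℝ} (hp : ContinuousOn p (Set.Icc 0 t))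
    (hq : ContinuousOn q (Set.Icc 0 t)) (hp0 : ∀ x ∈ Set.Icc 0 t, 0 < p x)
    (hpq : ∀ x ∈ Set.Icc 0 t, ∀ y ∈ Set.Icc 0 t, x < y → p x * q y < p y * q x) (N : ℕ) {s : ℝ}
    (hs : 0 ≤ s) (hst : s < t) :
    (∫ u in (0 : ℝ)..1, u ^ N * p (u * s)) * (∫ u in (0 : ℝ)..1, u ^ N * q (u * t)) <
      (∫ u in (0 : ℝ)..1, u ^ N * p (u * t)) * ∫ u in (0 : ℝ)..1, u ^ N * q (u * s) := by
  have ht : 0 < t := hs.trans_lt hst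
  have key : ∀ {y : ℝ → ℝ}, ContinuousOn y (Set.Icc 0 t) → ∀ {r : ℝ}, 0 ≤ r → r ≤ t →
      ContinuousOn (fun u : ℝ => u ^ N * y (u * r)) (Set.Icc 0 1) := by
    intro y hy r hr hrt
    refine ContinuousOn.mul (by fun_prop) (hy.comp (by fun_prop) fun u hu => ?_)
    exact ⟨mul_nonneg hu.1 hr, (mul_le_of_le_one_left hr hu.2).trans hrt⟩
  set ρ := s / t with hρ
  have hρ0 : 0 ≤ ρ := div_nonneg hs ht.le
  have hρ1 : ρ < 1 := (div_lt_one ht).2 hst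
  have hρt : ρ * t = s := div_mul_cancel₀ s ht.ne'
  have hsmem : s ∈ Set.Icc 0 t := ⟨hs, hst.le⟩
  have split : ∀ {y : ℝ → ℝ}, ContinuousOn y (Set.Icc 0 t) →
      ∫ u in (0 : ℝ)..1, u ^ N * y (u * t) =
        ρ ^ (N + 1) * (∫ u in (0 : ℝ)..1, u ^ N * y (u * s)) +
          ∫ u in ρ..1, u ^ N * y (u * t) := by
    intro y hy
    have hc := key hy ht.le le_rfl
    rw [← intervalIntegral.integral_add_adjacent_intervals (b := ρ)
      ((hc.mono (Set.Icc_subset_Icc_right hρ1.le)).intervalIntegrable_of_Icc hρ0)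
      ((hc.mono (Set.Icc_subset_Icc_left hρ0)).intervalIntegrable_of_Icc hρ1.le)]
    congr 1
    have h1 := intervalIntegral.mul_integral_comp_mul_right (a := 0) (b := 1)
      (f := fun u : ℝ => u ^ N * y (u * t)) ρ
    rw [zero_mul, one_mul] at h1
    rw [← h1, pow_succ', mul_assoc, ← intervalIntegral.integral_const_mul (ρ ^ N)]
    congr 1
    refine intervalIntegral.integral_congr fun u _ => ?_
    rw [mul_assoc u ρ t, hρt, mul_pow]
    ring
  have hmem : ∀ u ∈ Set.Icc (0 : ℝ) 1, u * s ∈ Set.Icc 0 t := fun u hu =>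
    ⟨mul_nonneg hu.1 hs, (mul_le_of_le_one_left hs hu.2).trans hst.le⟩
  have hmem' : ∀ u ∈ Set.Icc ρ 1, u * t ∈ Set.Icc 0 t := fun u hu =>
    ⟨mul_nonneg (hρ0.trans hu.1) ht.le, mul_le_of_le_one_left ht.le hu.2⟩
  have h1 : (∫ u in (0 : ℝ)..1, u ^ N * p (u * s)) * q s ≤
      p s * ∫ u in (0 : ℝ)..1, u ^ N * q (u * s) := by
    rw [← intervalIntegral.integral_mul_const, ← intervalIntegral.integral_const_mul]
    refine intervalIntegral.integral_mono_on zero_le_one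
      (((key hp hs hst.le).mul continuousOn_const).intervalIntegrable_of_Icc zero_le_one)
      ((continuousOn_const.mul (key hq hs hst.le)).intervalIntegrable_of_Icc zero_le_one) ?_
    intro u hu
    have hle : p (u * s) * q s ≤ p s * q (u * s) := by
      rcases (mul_le_of_le_one_left hs hu.2).lt_or_eq with h | h
      · exact (hpq _ (hmem u hu) _ hsmem h).le
      · rw [h]
    nlinarith [pow_nonneg hu.1 N]
  have hIcc : Set.Icc ρ 1 ⊆ Set.Icc (0 : ℝ) 1 := Set.Icc_subset_Icc_left hρ0
  have h2 : p s * (∫ u in ρ..1, u ^ N * q (u * t)) < (∫ u in ρ..1, u ^ N * p (u * t)) * q s := by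
    rw [← intervalIntegral.integral_mul_const, ← intervalIntegral.integral_const_mul]
    have hlt : ∀ u ∈ Set.Ioc ρ 1, p s * (u ^ N * q (u * t)) < u ^ N * p (u * t) * q s := by
      intro u hu
      have := hpq s hsmem _ (hmem' u ⟨hu.1.le, hu.2⟩) (by nlinarith [hu.1])
      nlinarith [pow_pos (hρ0.trans_lt hu.1) N]
    exact intervalIntegral.integral_lt_integral_of_continuousOn_of_le_of_exists_lt hρ1
      (continuousOn_const.mul ((key hq ht.le le_rfl).mono hIcc))
      (((key hp ht.le le_rfl).mono hIcc).mul continuousOn_const)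
      (fun u hu => (hlt u hu).le) ⟨1, ⟨hρ1.le, le_rfl⟩, hlt 1 ⟨hρ1, le_rfl⟩⟩
  have h3 : 0 < ∫ u in (0 : ℝ)..1, u ^ N * p (u * s) := by
    refine intervalIntegral.intervalIntegral_pos_of_pos_on
      ((key hp hs hst.le).intervalIntegrable_of_Icc zero_le_one) (fun u hu => ?_) zero_lt_one
    exact mul_pos (pow_pos hu.1 _) (hp0 _ (hmem u (Set.Ioo_subset_Icc_self hu)))
  have h5 : 0 < ∫ u in ρ..1, u ^ N * p (u * t) := by
    refine intervalIntegral.intervalIntegral_pos_of_pos_on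
      (((key hp ht.le le_rfl).mono hIcc).intervalIntegrable_of_Icc hρ1.le) (fun u hu => ?_) hρ1
    exact mul_pos (pow_pos (hρ0.trans_lt hu.1) _) (hp0 _ (hmem' u (Set.Ioo_subset_Icc_self hu)))
  rw [split hp, split hq]
  set A := ∫ u in (0 : ℝ)..1, u ^ N * p (u * s)
  set B := ∫ u in (0 : ℝ)..1, u ^ N * q (u * s)
  set A' := ∫ u in ρ..1, u ^ N * p (u * t)
  set B' := ∫ u in ρ..1, u ^ N * q (u * t)
  have hps := hp0 s hsmem
  have h4 : A * B' < A' * B := by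
    have e1 : (A * B') * p s < A * (A' * q s) := by
      calc (A * B') * p s = A * (p s * B') := by ring
        _ < _ := mul_lt_mul_of_pos_left h2 h3
    have e2 : A * (A' * q s) ≤ (A' * B) * p s := by
      calc A * (A' * q s) = A' * (A * q s) := by ring
        _ ≤ A' * (p s * B) := mul_le_mul_of_nonneg_left h1 h5.le
        _ = _ := by ring
    exact lt_of_mul_lt_mul_right (e1.trans_le e2) hps.le
  nlinarith

theorem slopeJet_cross_lt {N : ℕ} {F G : ℕ → ℝ → ℝ} (hF : IsJet (N + 1) F)
    (hG : IsJet (N + 1) G) (hF0 : ∀ x : ℝ, 0 < x → 0 < F (N + 1) x)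
    (hG0 : ∀ x : ℝ, 0 < x → 0 < G (N + 1) x)
    (hFG : ∀ x y : ℝ, 0 < x → x < y →
      F (N + 1) x * G (N + 1) y < F (N + 1) y * G (N + 1) x) {c : ℝ} (hc : 0 < c) (x y : ℝ)
    (hx : 0 < x) (hxy : x < y) :
    slopeJet c F N x * slopeJet c G N y < slopeJet c F N y * slopeJet c G N x := by
  have hy : 0 < y := hx.trans hxy
  have right : ∀ s t : ℝ, c ≤ s → s < t →
      slopeJet c F N s * slopeJet c G N t < slopeJet c F N t * slopeJet c G N s := by
    intro s t hs hst
    have hm : ∀ x ∈ Set.Icc 0 (t - c), 0 < c + x := fun x hx => by linarith [hx.1]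
    exact integral_pow_mul_cross_lt (p := fun x => F (N + 1) (c + x))
      (q := fun x => G (N + 1) (c + x)) (t := t - c)
      (hF.2.comp (by fun_prop) hm) (hG.2.comp (by fun_prop) hm)
      (fun x hx => hF0 _ (hm x hx))
      (fun x hx y hy hxy => hFG _ _ (hm x hx) (by linarith)) N (s := s - c)
      (by linarith) (by linarith)
  -- The reflection `x ↦ c - x` reverses the monotonicity of the ratio, so `F` and `G` exchange
  -- roles.
  have left : ∀ s t : ℝ, 0 < s → s < t → t ≤ c →
      slopeJet c F N s * slopeJet c G N t < slopeJet c F N t * slopeJet c G N s := by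
    intro s t hs hst htc
    have hm : ∀ x ∈ Set.Icc 0 (c - s), 0 < c - x := fun x hx => by linarith [hx.2]
    have h := integral_pow_mul_cross_lt (p := fun x => G (N + 1) (c - x))
      (q := fun x => F (N + 1) (c - x)) (t := c - s)
      (hG.2.comp (by fun_prop) hm) (hF.2.comp (by fun_prop) hm)
      (fun x hx => hG0 _ (hm x hx))
      (fun x hx y hy hxy => by
        have := hFG _ _ (hm y hy) (sub_lt_sub_left hxy c)
        linarith) N (s := c - t)
      (by linarith) (by linarith)
    have e : ∀ u r : ℝ, c - u * (c - r) = c + u * (r - c) := fun u r => by ring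
    simp only [e] at h
    simp only [slopeJet]
    linarith
  rcases le_or_gt c x with h | h
  · exact right x y h hxy
  rcases le_or_gt y c with h' | h'
  · exact left x y hx hxy h'
  -- When `c` lies between `x` and `y`, the two one-sided comparisons are chained through the value
  -- at `c`.
  have h1 := left x c hx h le_rfl
  have h2 := right c y le_rfl h'
  have p1 := slopeJet_pos hF hF0 hc hx
  have p2 := slopeJet_pos hF hF0 hc hc
  have p3 := slopeJet_pos hF hF0 hc hy
  have p4 := slopeJet_pos hG hG0 hc hx
  have p5 := slopeJet_pos hG hG0 hc hc
  have p6 := slopeJet_pos hG hG0 hc hy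
  have e1 := mul_lt_mul_of_pos_right h1 p6
  have e2 := mul_lt_mul_of_pos_right h2 p4
  refine lt_of_mul_lt_mul_right (a := slopeJet c G N c) ?_ p5.le
  nlinarith

/-! ### Monotonicity of functions vanishing to order `d` at an endpoint. -/

theorem pos_of_jet_pos {a b : ℝ} (d : ℕ) {E : ℕ → ℝ → ℝ}
    (hE : ∀ j < d, ∀ t ∈ Set.Icc a b, HasDerivAt (E j) (E (j + 1) t) t)
    (h0 : ∀ j < d, E j a = 0) (hpos : ∀ t ∈ Set.Ioo a b, 0 < E d t) :
    ∀ t ∈ Set.Ioo a b, 0 < E 0 t := by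
  induction d generalizing E with
  | zero => exact hpos
  | succ d ih =>
    have h1 := ih (E := fun j => E (j + 1)) (fun j hj => hE (j + 1) (by omega))
      (fun j hj => h0 (j + 1) (by omega)) hpos
    have h2 : StrictMonoOn (E 0) (Set.Icc a b) := by
      refine strictMonoOn_of_deriv_pos (convex_Icc a b)
        (fun t ht => (hE 0 (by omega) t ht).continuousAt.continuousWithinAt) fun t ht => ?_
      rw [interior_Icc] at ht
      rw [(hE 0 (by omega) t (Set.Ioo_subset_Icc_self ht)).deriv]
      exact h1 t ht
    intro t ht
    rw [← h0 0 (by omega)]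
    exact h2 ⟨le_rfl, (ht.1.trans ht.2).le⟩ (Set.Ioo_subset_Icc_self ht) ht.1

theorem strictMonoOn_of_jet_pos {a b : ℝ} {d : ℕ} (hd : 0 < d) {E : ℕ → ℝ → ℝ}
    (hE : ∀ j < d, ∀ t ∈ Set.Icc a b, HasDerivAt (E j) (E (j + 1) t) t)
    (h0 : ∀ j < d, E j a = 0) (hpos : ∀ t ∈ Set.Ioo a b, 0 < E d t) :
    StrictMonoOn (E 0) (Set.Icc a b) := by
  obtain ⟨d, rfl⟩ : ∃ e, d = e + 1 := ⟨d - 1, by omega⟩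
  refine strictMonoOn_of_deriv_pos (convex_Icc a b)
    (fun t ht => (hE 0 hd t ht).continuousAt.continuousWithinAt) fun t ht => ?_
  rw [interior_Icc] at ht
  rw [(hE 0 hd t (Set.Ioo_subset_Icc_self ht)).deriv]
  exact pos_of_jet_pos d (E := fun j => E (j + 1)) (fun j hj => hE (j + 1) (by omega))
    (fun j hj => h0 (j + 1) (by omega)) hpos t ht

theorem strictAntiOn_of_jet_pos {a b : ℝ} {d : ℕ} (hd : 0 < d) {E : ℕ → ℝ → ℝ}
    (hE : ∀ j < d, ∀ t ∈ Set.Icc a b, HasDerivAt (E j) (E (j + 1) t) t)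
    (h0 : ∀ j < d, E j b = 0) (hpos : ∀ t ∈ Set.Ioo a b, 0 < E d t) :
    StrictAntiOn (fun t => (-1) ^ d * E 0 t) (Set.Icc a b) := by
  -- Reflect in the origin. The `j`-th derivative acquires `(-1) ^ j`; the extra `(-1) ^ d` makes
  -- the top derivative positive again.
  have key := strictMonoOn_of_jet_pos (a := -b) (b := -a) hd
    (E := fun j t => (-1) ^ (d + j) * E j (-t)) ?_ ?_ ?_
  · intro s hs t ht hst
    have := key (a := -t) ⟨by linarith [ht.2], by linarith [ht.1]⟩ (b := -s)
      ⟨by linarith [hs.2], by linarith [hs.1]⟩ (by linarith)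
    simpa using this
  · intro j hj t ht
    have h1 := hE j hj (-t) ⟨by linarith [ht.2], by linarith [ht.1]⟩
    refine ((h1.comp t (hasDerivAt_neg t)).const_mul ((-1 : ℝ) ^ (d + j))).congr_deriv ?_
    rw [← add_assoc, pow_succ]
    ring
  · intro j hj
    simp [h0 j hj]
  · intro t ht
    simp only [← two_mul, pow_mul, neg_one_sq, one_pow, one_mul]
    exact hpos _ ⟨by linarith [ht.2], by linarith [ht.1]⟩

/-! ### Lifting polynomial approximations from the slope to the function. -/

theorem iterate_derivative_X_sub_C_mul (c : ℝ) (P : ℝ[X]) (j : ℕ) :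
    derivative^[j + 1] ((X - C c) * P) =
      (X - C c) * derivative^[j + 1] P + C ((j : ℝ) + 1) * derivative^[j] P := by
  induction j with
  | zero => simp [derivative_mul]; ring
  | succ j ih =>
    rw [Function.iterate_succ_apply', ih]
    simp only [map_add, derivative_mul, derivative_sub, derivative_X, derivative_C,
      Function.iterate_succ_apply', Nat.cast_add, Nat.cast_one, map_one, derivative_one]
    ring

theorem eval_iterate_derivative_C_add_X_sub_C_mul (A c y : ℝ) (P : ℝ[X]) (j : ℕ) :
    (derivative^[j + 1] (C A + (X - C c) * P)).eval y =
      (y - c) * (derivative^[j + 1] P).eval y + (j + 1) * (derivative^[j] P).eval y := by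
  rw [iterate_map_add, iterate_derivative_X_sub_C_mul]
  rw [Function.iterate_succ_apply derivative j (C A)]
  simp

theorem degree_C_add_X_sub_C_mul_lt {A c : ℝ} {P : ℝ[X]} {N : ℕ} (hP : P.degree < (N : ℕ)) :
    (C A + (X - C c) * P).degree < ((N + 1 : ℕ) : WithBot ℕ) := by
  refine (degree_add_le _ _).trans_lt (max_lt ?_ ?_)
  · exact degree_C_le.trans_lt (by exact_mod_cast Nat.succ_pos N)
  · by_cases h : P = 0
    · simp [h]
    · rw [degree_mul, degree_X_sub_C]
      rw [degree_eq_natDegree h] at hP ⊢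
      norm_cast at hP ⊢
      omega

theorem IsJet.eq_eval_of_slopeJet {N : ℕ} {H : ℕ → ℝ → ℝ} (h : IsJet (N + 1) H) {c y : ℝ}
    (hc : 0 < c) (hy : 0 < y) {P : ℝ[X]} {p : ℕ} (hp : p ≤ N)
    (hP : ∀ j < p, slopeJet c H j y = (derivative^[j] P).eval y) :
    (∀ j < p, H j y = (derivative^[j] (C (H 0 c) + (X - C c) * P)).eval y) ∧
      (y = c → ∀ j < p + 1, H j y = (derivative^[j] (C (H 0 c) + (X - C c) * P)).eval y) := by
  constructor
  · intro j hj
    cases j with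
    | zero =>
      have := hP 0 hj
      simp only [Function.iterate_zero, id] at this
      rw [h.eq_add_slopeJet hc hy, this]
      simp
    | succ j =>
      rw [eval_iterate_derivative_C_add_X_sub_C_mul, h.succ_eq_slopeJet hc j (by omega) y hy,
        hP _ hj, hP j (by omega)]
  · rintro rfl j hj
    cases j with
    | zero => simp
    | succ j =>
      rw [eval_iterate_derivative_C_add_X_sub_C_mul, h.succ_eq_slopeJet hc j (by omega) y hy,
        hP j (by omega)]
      simp

/-- The effect on derivatives of dividing by `(x - a) (x - b)` after subtracting the interpolant
at `a` and `b`. -/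
noncomputable def biSlopeJet (a b : ℝ) (H : ℕ → ℝ → ℝ) : ℕ → ℝ → ℝ :=
  slopeJet b (slopeJet a H)

theorem isJet_iterate_biSlopeJet {a b : ℝ} (ha : 0 < a) (hb : 0 < b) {d : ℕ} (m : ℕ) :
    ∀ {H : ℕ → ℝ → ℝ}, IsJet (2 * m + d) H → IsJet d ((biSlopeJet a b)^[m] H) := by
  induction m with
  | zero => intro H h; simpa using h
  | succ m ih =>
    intro H h
    rw [show 2 * (m + 1) + d = 2 * m + d + 1 + 1 by ring] at h
    exact ih (isJet_slopeJet (isJet_slopeJet h ha) hb)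

theorem iterate_biSlopeJet_pos {a b : ℝ} (ha : 0 < a) (hb : 0 < b) {d : ℕ} (m : ℕ) :
    ∀ {H : ℕ → ℝ → ℝ}, IsJet (2 * m + d) H → (∀ x : ℝ, 0 < x → 0 < H (2 * m + d) x) →
      ∀ x : ℝ, 0 < x → 0 < (biSlopeJet a b)^[m] H d x := by
  induction m with
  | zero => intro H _ h; simpa using h
  | succ m ih =>
    intro H h h0
    rw [show 2 * (m + 1) + d = 2 * m + d + 1 + 1 by ring] at h h0
    have h1 := isJet_slopeJet h ha
    exact ih (isJet_slopeJet h1 hb) fun x hx =>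
      slopeJet_pos h1 (fun y hy => slopeJet_pos h h0 ha hy) hb hx

theorem iterate_biSlopeJet_cross_lt {a b : ℝ} (ha : 0 < a) (hb : 0 < b) {d : ℕ} (m : ℕ) :
    ∀ {F G : ℕ → ℝ → ℝ}, IsJet (2 * m + d) F → IsJet (2 * m + d) G →
      (∀ x : ℝ, 0 < x → 0 < F (2 * m + d) x) → (∀ x : ℝ, 0 < x → 0 < G (2 * m + d) x) →
      (∀ x y : ℝ, 0 < x → x < y →
        F (2 * m + d) x * G (2 * m + d) y < F (2 * m + d) y * G (2 * m + d) x) →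
      ∀ x y : ℝ, 0 < x → x < y →
        (biSlopeJet a b)^[m] F d x * (biSlopeJet a b)^[m] G d y <
          (biSlopeJet a b)^[m] F d y * (biSlopeJet a b)^[m] G d x := by
  induction m with
  | zero => intro F G _ _ _ _ h; simpa using h
  | succ m ih =>
    intro F G hF hG hF0 hG0 hFG
    rw [show 2 * (m + 1) + d = 2 * m + d + 1 + 1 by ring] at hF hG hF0 hG0 hFG
    have hF1 := isJet_slopeJet hF ha
    have hG1 := isJet_slopeJet hG ha
    have hF2 : ∀ x : ℝ, 0 < x → 0 < slopeJet a F (2 * m + d + 1) x :=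
      fun y hy => slopeJet_pos hF hF0 ha hy
    have hG2 : ∀ x : ℝ, 0 < x → 0 < slopeJet a G (2 * m + d + 1) x :=
      fun y hy => slopeJet_pos hG hG0 ha hy
    exact ih (isJet_slopeJet hF1 hb) (isJet_slopeJet hG1 hb)
      (fun x hx => slopeJet_pos hF1 hF2 hb hx) (fun x hx => slopeJet_pos hG1 hG2 hb hx)
      (slopeJet_cross_lt hF1 hG1 hF2 hG2 (slopeJet_cross_lt hF hG hF0 hG0 hFG ha) hb)

/-- A polynomial that approximates the function left after dividing `m` times by
`(x - a) (x - b)` lifts to one that approximates the function itself, with `m` additional orders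
of contact at `a` and at `b`. -/
theorem exists_lift_biSlopeJet {a b : ℝ} (ha : 0 < a) (hb : 0 < b) {d : ℕ} {T : ℝ[X]}
    (hT : T.degree < (d : ℕ)) (m : ℕ) :
    ∀ {H : ℕ → ℝ → ℝ}, IsJet (2 * m + d) H → ∃ P : ℝ[X],
      P.degree < ((2 * m + d : ℕ) : WithBot ℕ) ∧
      (∀ x : ℝ, 0 < x → H 0 x - P.eval x =
        ((x - a) * (x - b)) ^ m * ((biSlopeJet a b)^[m] H 0 x - T.eval x)) ∧
      ∀ y : ℝ, (y = a ∨ y = b) → ∀ p ≤ d,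
        (∀ j < p, (biSlopeJet a b)^[m] H j y = (derivative^[j] T).eval y) →
        ∀ j < p + m, H j y = (derivative^[j] P).eval y := by
  induction m with
  | zero => intro H _; exact ⟨T, by simpa using hT, by simp, by simp⟩
  | succ m ih =>
    intro H h
    rw [show 2 * (m + 1) + d = 2 * m + d + 1 + 1 by ring] at h ⊢
    have h1 := isJet_slopeJet h ha
    obtain ⟨P, hP, hPx, hPy⟩ := ih (isJet_slopeJet h1 hb)
    refine ⟨_, degree_C_add_X_sub_C_mul_lt (A := H 0 a) (c := a)
      (degree_C_add_X_sub_C_mul_lt (A := slopeJet a H 0 b) (c := b) hP), ?_, ?_⟩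
    · intro x hx
      have e := hPx x hx
      rw [h.eq_add_slopeJet ha hx, h1.eq_add_slopeJet hb hx]
      simp only [eval_add, eval_mul, eval_sub, eval_X, eval_C, Function.iterate_succ_apply,
        biSlopeJet] at e ⊢
      rw [pow_succ']
      linear_combination (x - a) * (x - b) * e
    · intro y hy p hp hj
      have hy0 : 0 < y := by rcases hy with rfl | rfl <;> assumption
      -- Undo the slope at `b`, then the one at `a`: each gains one order of contact at its own node
      -- and keeps the order at the other.
      obtain ⟨s1, s2⟩ := h1.eq_eval_of_slopeJet hb hy0 (p := p + m) (by omega) (hPy y hy p hp hj)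
      rcases hy with rfl | rfl
      · exact (h.eq_eval_of_slopeJet ha hy0 (p := p + m) (by omega) s1).2 rfl
      · exact (h.eq_eval_of_slopeJet ha hy0 (p := p + m + 1) (by omega) (s2 rfl)).1

/-! ### Taylor polynomials and uniqueness of Hermite interpolants. -/

theorem exists_taylor_polynomial (a : ℝ) (d : ℕ) (c : ℕ → ℝ) : ∃ T : ℝ[X],
    T.degree < (d : ℕ) ∧ ∀ j < d, (derivative^[j] T).eval a = c j := by
  -- `taylor (-a)` substitutes `X - a` for `X`.
  refine ⟨taylor (-a) (∑ i ∈ Finset.range d, C (c i / i.factorial) * X ^ i), ?_, ?_⟩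
  · rw [degree_taylor]
    refine degree_lt_iff_coeff_zero _ _ |>.2 fun k hk => ?_
    rw [finsetSum_coeff]
    refine Finset.sum_eq_zero fun i hi => ?_
    rw [coeff_C_mul_X_pow, if_neg]
    have := Finset.mem_range.1 hi
    omega
  · intro j hj
    rw [← factorial_smul_hasseDeriv, LinearMap.smul_apply, eval_smul, ← taylor_coeff,
      taylor_taylor, add_neg_cancel, taylor_zero, finsetSum_coeff]
    simp only [coeff_C_mul_X_pow]
    rw [Finset.sum_ite_eq (Finset.range d) j, if_pos (Finset.mem_range.2 hj), nsmul_eq_mul,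
      mul_div_cancel₀]
    exact_mod_cast j.factorial_ne_zero

/-- The difference is divisible by `(X - a) ^ (k + 1) * (X - b) ^ (l + 1)`, whose degree `k + l + 2`
is too large unless it is zero. -/
theorem IsHermiteInterpolant.unique {f : ℝ → ℝ} {a b : ℝ} (hab : a ≠ b) {k l : ℕ} {P Q : ℝ[X]}
    (hP : IsHermiteInterpolant f a b k l P) (hQ : IsHermiteInterpolant f a b k l Q) : P = Q := by
  by_contra hne
  have hne' : P - Q ≠ 0 := sub_ne_zero.2 hne
  have h1 : (X - C a) ^ (k + 1) ∣ P - Q := by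
    rw [← le_rootMultiplicity_iff hne']
    refine (lt_rootMultiplicity_iff_isRoot_iterate_derivative hne').2 fun j hj => ?_
    rw [IsRoot, iterate_derivative_sub, eval_sub, hP.2.1 j hj, hQ.2.1 j hj, sub_self]
  have h2 : (X - C b) ^ (l + 1) ∣ P - Q := by
    rw [← le_rootMultiplicity_iff hne']
    refine (lt_rootMultiplicity_iff_isRoot_iterate_derivative hne').2 fun j hj => ?_
    rw [IsRoot, iterate_derivative_sub, eval_sub, hP.2.2 j hj, hQ.2.2 j hj, sub_self]
  have h3 := natDegree_le_of_dvd
    (((isCoprime_X_sub_C_of_isUnit_sub (sub_ne_zero.2 hab).isUnit).pow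
      (m := k + 1) (n := l + 1)).mul_dvd h1 h2) hne'
  rw [natDegree_mul (pow_ne_zero _ (X_sub_C_ne_zero a)) (pow_ne_zero _ (X_sub_C_ne_zero b)),
    natDegree_pow, natDegree_pow, natDegree_X_sub_C, natDegree_X_sub_C] at h3
  have h4 : (P - Q).natDegree ≤ k + l + 1 :=
    natDegree_le_iff_degree_le.2 ((degree_sub_le _ _).trans (max_le hP.1 hQ.1))
  omega

theorem isJet_iteratedDeriv {N : ℕ} {f : ℝ → ℝ} (hf : ContDiffOn ℝ (N : WithTop ℕ∞) f (Set.Ioi 0)) :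
    IsJet N fun j => iteratedDeriv j f := by
  have hu : UniqueDiffOn ℝ (Set.Ioi (0 : ℝ)) := isOpen_Ioi.uniqueDiffOn
  have heq : ∀ j, Set.EqOn (iteratedDerivWithin j f (Set.Ioi 0)) (iteratedDeriv j f)
      (Set.Ioi 0) := fun j => iteratedDerivWithin_of_isOpen isOpen_Ioi
  constructor
  · intro j hj x hx
    have h1 := (hf.differentiableOn_iteratedDerivWithin (m := j) (by exact_mod_cast hj) hu).congr
      (fun y hy => (heq j hy).symm)
    simp only [iteratedDeriv_succ]
    exact (h1.differentiableAt (Ioi_mem_nhds hx)).hasDerivAt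
  · exact (hf.continuousOn_iteratedDerivWithin le_rfl hu).congr fun y hy => (heq N hy).symm

/-! ### The equation of the mean and its unique solution. -/

theorem isHermiteMeanPoint_iff {f : ℝ → ℝ} {m₁ m₂ : ℕ} (hm : m₂ < m₁) {a b : ℝ} (ha : 0 < a)
    (hb : 0 < b) (hab : a ≠ b) (hf : IsJet (m₁ + m₂ + 2) fun j => iteratedDeriv j f)
    {K : ℕ → ℝ → ℝ} (hK : K = (biSlopeJet a b)^[m₂ + 1] fun j => iteratedDeriv j f) {S T : ℝ[X]}
    (hS : S.degree < ((m₁ - m₂ : ℕ) : WithBot ℕ)) (hT : T.degree < ((m₁ - m₂ : ℕ) : WithBot ℕ))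
    (hSa : ∀ j < m₁ - m₂, (derivative^[j] S).eval a = K j a)
    (hTb : ∀ j < m₁ - m₂, (derivative^[j] T).eval b = K j b) (x : ℝ) :
    IsHermiteMeanPoint f m₁ m₂ a b x ↔ x ∈ Set.uIoo a b ∧
      K 0 x - S.eval x - (-1) ^ (m₁ - m₂) * (K 0 x - T.eval x) = 0 := by
  subst hK
  have hN : m₁ + m₂ + 2 = 2 * (m₂ + 1) + (m₁ - m₂) := by omega
  rw [hN] at hf
  obtain ⟨P, hP, hPx, hPy⟩ := exists_lift_biSlopeJet ha hb hS (m₂ + 1) hf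
  obtain ⟨Q, hQ, hQx, hQy⟩ := exists_lift_biSlopeJet ha hb hT (m₂ + 1) hf
  have hdeg : ∀ {R : ℝ[X]} {k : ℕ}, R.degree < ((2 * (m₂ + 1) + (m₁ - m₂) : ℕ) : WithBot ℕ) →
      k = m₁ + m₂ + 1 → R.degree ≤ ((k : ℕ) : WithBot ℕ) := by
    intro R k h hk
    rw [degree_lt_iff_coeff_zero] at h
    rw [degree_le_iff_coeff_zero]
    exact fun j hj => h j (by have : k < j := by exact_mod_cast hj
                              omega)
  -- Contact of order `m₁ - m₂` at `a` and `0` at `b` before lifting becomes `m₁ + 1` and `m₂ + 1`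
  -- after it.
  have hPI : IsHermiteInterpolant f a b m₁ m₂ P :=
    ⟨hdeg hP rfl, fun j hj => (hPy a (.inl rfl) (m₁ - m₂) le_rfl
        (fun i hi => (hSa i hi).symm) j (by omega)).symm,
      fun j hj => (hPy b (.inr rfl) 0 (Nat.zero_le _) (fun i hi => absurd hi (by omega)) j
        (by omega)).symm⟩
  have hQI : IsHermiteInterpolant f a b m₂ m₁ Q :=
    ⟨hdeg hQ (by omega), fun j hj => (hQy a (.inl rfl) 0 (Nat.zero_le _)
        (fun i hi => absurd hi (by omega)) j (by omega)).symm,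
      fun j hj => (hQy b (.inr rfl) (m₁ - m₂) le_rfl
        (fun i hi => (hTb i hi).symm) j (by omega)).symm⟩
  have hiff : ∀ x ∈ Set.uIoo a b,
      ((if Even (m₁ - m₂) then P.eval x = Q.eval x else f x = (P.eval x + Q.eval x) / 2) ↔
        (biSlopeJet a b)^[m₂ + 1] (fun j => iteratedDeriv j f) 0 x - S.eval x -
          (-1) ^ (m₁ - m₂) *
            ((biSlopeJet a b)^[m₂ + 1] (fun j => iteratedDeriv j f) 0 x - T.eval x) = 0) := by
    intro x hx
    have hx' : min a b < x ∧ x < max a b := hx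
    have hx0 : 0 < x := (lt_min ha hb).trans hx'.1
    have hxa : x - a ≠ 0 := by
      rintro h
      obtain rfl : x = a := by linarith
      rcases lt_or_gt_of_ne hab with h | h
      · simp [h.le] at hx'
      · simp [h.le] at hx'
    have hxb : x - b ≠ 0 := by
      rintro h
      obtain rfl : x = b := by linarith
      rcases lt_or_gt_of_ne hab with h | h
      · simp [h.le] at hx'
      · simp [h.le] at hx'
    have hw : ((x - a) * (x - b)) ^ (m₂ + 1) ≠ 0 := pow_ne_zero _ (mul_ne_zero hxa hxb)
    have e1 := hPx x hx0
    have e2 := hQx x hx0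
    simp only [iteratedDeriv_zero] at e1 e2
    set k := (biSlopeJet a b)^[m₂ + 1] (fun j => iteratedDeriv j f) 0 x
    set w := ((x - a) * (x - b)) ^ (m₂ + 1)
    split_ifs with hd
    · rw [hd.neg_one_pow]
      constructor
      · intro h
        refine (mul_eq_zero.1 ?_).resolve_left hw
        linear_combination e2 - e1 - h
      · intro h
        linear_combination e2 - e1 - w * h
    · rw [(Nat.not_even_iff_odd.1 hd).neg_one_pow]
      constructor
      · intro h
        refine (mul_eq_zero.1 ?_).resolve_left hw
        linear_combination -e2 - e1 + 2 * h
      · intro h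
        linear_combination (e2 + e1 + w * h) / 2
  constructor
  · rintro ⟨hx, P', Q', hP', hQ', h⟩
    rw [hP'.unique hab hPI, hQ'.unique hab hQI] at h
    exact ⟨hx, (hiff x hx).1 h⟩
  · rintro ⟨hx, h⟩
    exact ⟨hx, P, Q, hPI, hQI, (hiff x hx).2 h⟩

/-- Both `A 0` and `-(-1) ^ d * B 0` are strictly increasing, and they vanish at `a` and at `b`
respectively. The last clause locates a point relative to the zero by the sign there; the comparison
of means rests on it. -/
theorem existsUnique_zero_of_jets {a b : ℝ} (hab : a < b) {d : ℕ} (hd : 0 < d)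
    {A B : ℕ → ℝ → ℝ} (hA : ∀ j < d, ∀ t ∈ Set.Icc a b, HasDerivAt (A j) (A (j + 1) t) t)
    (hB : ∀ j < d, ∀ t ∈ Set.Icc a b, HasDerivAt (B j) (B (j + 1) t) t)
    (hAa : ∀ j < d, A j a = 0) (hBb : ∀ j < d, B j b = 0)
    (hA0 : ∀ t ∈ Set.Ioo a b, 0 < A d t) (hB0 : ∀ t ∈ Set.Ioo a b, 0 < B d t) :
    ∃ x ∈ Set.Ioo a b, A 0 x - (-1) ^ d * B 0 x = 0 ∧
      (∀ y ∈ Set.Ioo a b, A 0 y - (-1) ^ d * B 0 y = 0 → y = x) ∧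
      ∀ y ∈ Set.Ioo a b, A 0 y - (-1) ^ d * B 0 y < 0 → y < x := by
  have h1 := strictMonoOn_of_jet_pos hd hA hAa hA0
  have h2 := strictAntiOn_of_jet_pos hd hB hBb hB0
  have ha : a ∈ Set.Icc a b := ⟨le_rfl, hab.le⟩
  have hb : b ∈ Set.Icc a b := ⟨hab.le, le_rfl⟩
  have hmono : StrictMonoOn (fun x => A 0 x - (-1) ^ d * B 0 x) (Set.Icc a b) :=
    fun s hs t ht hst => sub_lt_sub (h1 hs ht hst) (h2 hs ht hst)
  have hcont : ContinuousOn (fun x => A 0 x - (-1) ^ d * B 0 x) (Set.Icc a b) := fun t ht =>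
    ((hA 0 hd t ht).continuousAt.sub
      (continuousAt_const.mul (hB 0 hd t ht).continuousAt)).continuousWithinAt
  have hna : A 0 a - (-1) ^ d * B 0 a < 0 := by
    have := h2 ha hb hab
    simp only [hBb 0 hd, mul_zero] at this
    rw [hAa 0 hd]
    linarith
  have hpb : 0 < A 0 b - (-1) ^ d * B 0 b := by
    have := h1 ha hb hab
    rw [hAa 0 hd] at this
    rw [hBb 0 hd]
    linarith
  obtain ⟨x, hx, hx0⟩ := intermediate_value_Ioo hab.le hcont ⟨hna, hpb⟩
  refine ⟨x, hx, hx0, fun y hy hy0 => ?_, fun y hy hy0 => ?_⟩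
  · exact hmono.injOn (Set.Ioo_subset_Icc_self hy) (Set.Ioo_subset_Icc_self hx)
      (hy0.trans hx0.symm)
  · refine (hmono.lt_iff_lt (Set.Ioo_subset_Icc_self hy) (Set.Ioo_subset_Icc_self hx)).1 ?_
    exact hy0.trans_eq hx0.symm

theorem IsJet.hasDerivAt_sub_polynomial {d : ℕ} {K : ℕ → ℝ → ℝ} (hK : IsJet d K) (T : ℝ[X]) {j : ℕ}
    (hj : j < d) {t : ℝ} (ht : 0 < t) :
    HasDerivAt (fun x => K j x - (derivative^[j] T).eval x)
      (K (j + 1) t - (derivative^[j + 1] T).eval t) t := by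
  refine (hK.1 j hj t ht).sub ?_
  rw [Function.iterate_succ_apply']
  exact (derivative^[j] T).hasDerivAt t

theorem existsUnique_isHermiteMeanPoint {f : ℝ → ℝ} {m₁ m₂ : ℕ} (hm : m₂ < m₁) {a b : ℝ}
    (ha : 0 < a) (hab : a < b) (hf : IsJet (m₁ + m₂ + 2) fun j => iteratedDeriv j f)
    (hf0 : ∀ x : ℝ, 0 < x → 0 < iteratedDeriv (m₁ + m₂ + 2) f x) :
    ∃! x, IsHermiteMeanPoint f m₁ m₂ a b x := by
  have hb := ha.trans hab
  have hd : 0 < m₁ - m₂ := by omega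
  have hN : m₁ + m₂ + 2 = 2 * (m₂ + 1) + (m₁ - m₂) := by omega
  obtain ⟨K, hK⟩ : ∃ K, K = (biSlopeJet a b)^[m₂ + 1] fun j => iteratedDeriv j f := ⟨_, rfl⟩
  have hKj : IsJet (m₁ - m₂) K := hK ▸ isJet_iterate_biSlopeJet ha hb _ (hN ▸ hf)
  have hK0 : ∀ x : ℝ, 0 < x → 0 < K (m₁ - m₂) x := by
    rw [hK]
    exact iterate_biSlopeJet_pos ha hb _ (hN ▸ hf) (fun x hx => hN ▸ hf0 x hx)
  obtain ⟨S, hS, hSa⟩ := exists_taylor_polynomial a (m₁ - m₂) fun j => K j a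
  obtain ⟨T, hT, hTb⟩ := exists_taylor_polynomial b (m₁ - m₂) fun j => K j b
  have hpos : ∀ t ∈ Set.Icc a b, 0 < t := fun t ht => ha.trans_le ht.1
  obtain ⟨x, hx, hx0, huniq, -⟩ := existsUnique_zero_of_jets hab hd
    (A := fun j x => K j x - (derivative^[j] S).eval x)
    (B := fun j x => K j x - (derivative^[j] T).eval x)
    (fun j hj t ht => hKj.hasDerivAt_sub_polynomial S hj (hpos t ht))
    (fun j hj t ht => hKj.hasDerivAt_sub_polynomial T hj (hpos t ht))
    (fun j hj => by simp [hSa j hj]) (fun j hj => by simp [hTb j hj])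
    (fun t ht => by
      simpa [iterate_derivative_eq_zero_of_degree_lt hS] using hK0 t (ha.trans ht.1))
    (fun t ht => by
      simpa [iterate_derivative_eq_zero_of_degree_lt hT] using hK0 t (ha.trans ht.1))
  have hiff := isHermiteMeanPoint_iff hm ha hb hab.ne hf hK hS hT hSa hTb
  rw [Set.uIoo_of_lt hab] at hiff
  exact ⟨x, (hiff x).2 ⟨hx, hx0⟩, fun y hy => huniq y ((hiff y).1 hy).1 ((hiff y).1 hy).2⟩

/-! ### Comparison of two means. -/

theorem IsHermiteMeanPoint.lt_of_cross_lt {f g : ℝ → ℝ} {m₁ m₂ : ℕ} (hm : m₂ < m₁) {a b : ℝ}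
    (ha : 0 < a) (hab : a < b) (hf : IsJet (m₁ + m₂ + 2) fun j => iteratedDeriv j f)
    (hg : IsJet (m₁ + m₂ + 2) fun j => iteratedDeriv j g)
    (hf0 : ∀ x : ℝ, 0 < x → 0 < iteratedDeriv (m₁ + m₂ + 2) f x)
    (hg0 : ∀ x : ℝ, 0 < x → 0 < iteratedDeriv (m₁ + m₂ + 2) g x)
    (hfg : ∀ x y : ℝ, 0 < x → x < y →
      iteratedDeriv (m₁ + m₂ + 2) f x * iteratedDeriv (m₁ + m₂ + 2) g y <
        iteratedDeriv (m₁ + m₂ + 2) f y * iteratedDeriv (m₁ + m₂ + 2) g x) {x y : ℝ}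
    (hx : IsHermiteMeanPoint g m₁ m₂ a b x) (hy : IsHermiteMeanPoint f m₁ m₂ a b y) : x < y := by
  have hb := ha.trans hab
  have hd : 0 < m₁ - m₂ := by omega
  have hN : m₁ + m₂ + 2 = 2 * (m₂ + 1) + (m₁ - m₂) := by omega
  obtain ⟨K, hK⟩ : ∃ K, K = (biSlopeJet a b)^[m₂ + 1] fun j => iteratedDeriv j f := ⟨_, rfl⟩
  obtain ⟨L, hL⟩ : ∃ L, L = (biSlopeJet a b)^[m₂ + 1] fun j => iteratedDeriv j g := ⟨_, rfl⟩
  have hKj : IsJet (m₁ - m₂) K := hK ▸ isJet_iterate_biSlopeJet ha hb _ (hN ▸ hf)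
  have hLj : IsJet (m₁ - m₂) L := hL ▸ isJet_iterate_biSlopeJet ha hb _ (hN ▸ hg)
  have hK0 : ∀ x : ℝ, 0 < x → 0 < K (m₁ - m₂) x := by
    rw [hK]
    exact iterate_biSlopeJet_pos ha hb _ (hN ▸ hf) (fun x hx => hN ▸ hf0 x hx)
  have hL0 : ∀ x : ℝ, 0 < x → 0 < L (m₁ - m₂) x := by
    rw [hL]
    exact iterate_biSlopeJet_pos ha hb _ (hN ▸ hg) (fun x hx => hN ▸ hg0 x hx)
  have hKL : ∀ x y : ℝ, 0 < x → x < y →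
      K (m₁ - m₂) x * L (m₁ - m₂) y < K (m₁ - m₂) y * L (m₁ - m₂) x := by
    rw [hK, hL]
    exact iterate_biSlopeJet_cross_lt ha hb _ (hN ▸ hf) (hN ▸ hg) (fun x hx => hN ▸ hf0 x hx)
      (fun x hx => hN ▸ hg0 x hx) (fun x y hx hxy => hN ▸ hfg x y hx hxy)
  obtain ⟨S, hS, hSa⟩ := exists_taylor_polynomial a (m₁ - m₂) fun j => K j a
  obtain ⟨T, hT, hTb⟩ := exists_taylor_polynomial b (m₁ - m₂) fun j => K j b
  obtain ⟨U, hU, hUa⟩ := exists_taylor_polynomial a (m₁ - m₂) fun j => L j a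
  obtain ⟨V, hV, hVb⟩ := exists_taylor_polynomial b (m₁ - m₂) fun j => L j b
  have hpos : ∀ t ∈ Set.Icc a b, 0 < t := fun t ht => ha.trans_le ht.1
  obtain ⟨z, hz, hz0, huniq, hlt⟩ := existsUnique_zero_of_jets hab hd
    (A := fun j x => K j x - (derivative^[j] S).eval x)
    (B := fun j x => K j x - (derivative^[j] T).eval x)
    (fun j hj t ht => hKj.hasDerivAt_sub_polynomial S hj (hpos t ht))
    (fun j hj t ht => hKj.hasDerivAt_sub_polynomial T hj (hpos t ht))
    (fun j hj => by simp [hSa j hj]) (fun j hj => by simp [hTb j hj])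
    (fun t ht => by
      simpa [iterate_derivative_eq_zero_of_degree_lt hS] using hK0 t (ha.trans ht.1))
    (fun t ht => by
      simpa [iterate_derivative_eq_zero_of_degree_lt hT] using hK0 t (ha.trans ht.1))
  rw [isHermiteMeanPoint_iff hm ha hb hab.ne hf hK hS hT hSa hTb, Set.uIoo_of_lt hab] at hy
  rw [isHermiteMeanPoint_iff hm ha hb hab.ne hg hL hU hV hUa hVb, Set.uIoo_of_lt hab] at hx
  obtain ⟨hx, hx0⟩ := hx
  rw [huniq y hy.1 hy.2]
  refine hlt x hx ?_
  have hxpos : 0 < x := ha.trans hx.1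
  -- With this multiplier, the `d`-th derivative of `K 0 - l * L 0` is negative on `(a, x)` and
  -- positive on `(x, b)`.
  set l := K (m₁ - m₂) x / L (m₁ - m₂) x with hl
  have hlx : l * L (m₁ - m₂) x = K (m₁ - m₂) x := div_mul_cancel₀ _ (hL0 x hxpos).ne'
  have h1 := strictMonoOn_of_jet_pos (a := a) (b := x) hd
    (E := fun j t => l * (L j t - (derivative^[j] U).eval t) -
      (K j t - (derivative^[j] S).eval t))
    (fun j hj t ht => ((hLj.hasDerivAt_sub_polynomial U hj (ha.trans_le ht.1)).const_mul l).sub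
      (hKj.hasDerivAt_sub_polynomial S hj (ha.trans_le ht.1)))
    (fun j hj => by simp [hSa j hj, hUa j hj])
    (fun t ht => by
      simp only [iterate_derivative_eq_zero_of_degree_lt hS,
        iterate_derivative_eq_zero_of_degree_lt hU, eval_zero, sub_zero, sub_pos]
      refine lt_of_mul_lt_mul_right (a := L (m₁ - m₂) x) ?_ (hL0 x hxpos).le
      calc _ < K (m₁ - m₂) x * L (m₁ - m₂) t := hKL t x (ha.trans ht.1) ht.2
        _ = _ := by rw [← hlx]; ring)
    ⟨le_rfl, hx.1.le⟩ ⟨hx.1.le, le_rfl⟩ hx.1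
  have h2 := strictAntiOn_of_jet_pos (a := x) (b := b) hd
    (E := fun j t => (K j t - (derivative^[j] T).eval t) -
      l * (L j t - (derivative^[j] V).eval t))
    (fun j hj t ht => (hKj.hasDerivAt_sub_polynomial T hj (hxpos.trans_le ht.1)).sub
      ((hLj.hasDerivAt_sub_polynomial V hj (hxpos.trans_le ht.1)).const_mul l))
    (fun j hj => by simp [hTb j hj, hVb j hj])
    (fun t ht => by
      simp only [iterate_derivative_eq_zero_of_degree_lt hT,
        iterate_derivative_eq_zero_of_degree_lt hV, eval_zero, sub_zero, sub_pos]
      refine lt_of_mul_lt_mul_right (a := L (m₁ - m₂) x) ?_ (hL0 x hxpos).le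
      calc _ = K (m₁ - m₂) x * L (m₁ - m₂) t := by rw [← hlx]; ring
        _ < _ := hKL x t hxpos ht.1)
    ⟨le_rfl, hx.2.le⟩ ⟨hx.2.le, le_rfl⟩ hx.2
  have e1 := hSa 0 hd
  have e2 := hUa 0 hd
  have e3 := hTb 0 hd
  have e4 := hVb 0 hd
  simp only [Function.iterate_zero, id] at e1 e2 e3 e4 h1 h2 ⊢
  simp only [e1, e2, e3, e4, sub_self, mul_zero] at h1 h2
  -- `h1` bounds the error at `a` and `h2` the signed error at `b`; together the left side for `f`
  -- is below `l` times that for `g`, which is zero at `x`.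
  linear_combination h1 + h2 + l * hx0

/-! ### Symmetry in the nodes, change of sign, and the theorem. -/

theorem isHermiteInterpolant_comm {f : ℝ → ℝ} {a b : ℝ} {k l : ℕ} {P : ℝ[X]} :
    IsHermiteInterpolant f a b k l P ↔ IsHermiteInterpolant f b a l k P := by
  unfold IsHermiteInterpolant
  rw [add_comm k l]
  tauto

theorem isHermiteMeanPoint_comm {f : ℝ → ℝ} {m₁ m₂ : ℕ} {a b x : ℝ} :
    IsHermiteMeanPoint f m₁ m₂ a b x ↔ IsHermiteMeanPoint f m₁ m₂ b a x := by
  have key : ∀ {a b : ℝ}, IsHermiteMeanPoint f m₁ m₂ a b x → IsHermiteMeanPoint f m₁ m₂ b a x := by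
    rintro a b ⟨hx, P, Q, hP, hQ, h⟩
    refine ⟨Set.uIoo_comm a b ▸ hx, Q, P, isHermiteInterpolant_comm.1 hQ,
      isHermiteInterpolant_comm.1 hP, ?_⟩
    split_ifs at h ⊢
    · exact h.symm
    · rw [h, add_comm]
  exact ⟨key, key⟩

theorem isHermiteMeanPoint_neg {f : ℝ → ℝ} {m₁ m₂ : ℕ} {a b x : ℝ} :
    IsHermiteMeanPoint (-f) m₁ m₂ a b x ↔ IsHermiteMeanPoint f m₁ m₂ a b x := by
  have hI : ∀ {f : ℝ → ℝ} {k l : ℕ} {P : ℝ[X]}, IsHermiteInterpolant f a b k l P →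
      IsHermiteInterpolant (-f) a b k l (-P) := by
    rintro f k l P ⟨h1, h2, h3⟩
    refine ⟨by rwa [degree_neg], fun j hj => ?_, fun j hj => ?_⟩
    · rw [iterate_derivative_neg, eval_neg, h2 j hj, iteratedDeriv_neg]
    · rw [iterate_derivative_neg, eval_neg, h3 j hj, iteratedDeriv_neg]
  have key : ∀ {f : ℝ → ℝ}, IsHermiteMeanPoint f m₁ m₂ a b x →
      IsHermiteMeanPoint (-f) m₁ m₂ a b x := by
    rintro f ⟨hx, P, Q, hP, hQ, h⟩
    refine ⟨hx, -P, -Q, hI hP, hI hQ, ?_⟩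
    simp only [eval_neg, Pi.neg_apply]
    split_ifs at h ⊢
    · rw [h]
    · rw [h]; ring
  exact ⟨fun h => neg_neg f ▸ key h, key⟩

theorem isHermiteMeanPoint_hermiteMean {f : ℝ → ℝ} {m₁ m₂ : ℕ} {a b : ℝ}
    (h : ∃! x, IsHermiteMeanPoint f m₁ m₂ a b x) :
    IsHermiteMeanPoint f m₁ m₂ a b (hermiteMean f m₁ m₂ a b) := by
  rw [hermiteMean, dif_pos h]
  exact h.choose_spec.1

theorem exists_sign_of_iteratedDeriv_ne_zero {N : ℕ} {f : ℝ → ℝ}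
    (hf : ContDiffOn ℝ (N : WithTop ℕ∞) f (Set.Ioi 0))
    (hf0 : ∀ x : ℝ, 0 < x → iteratedDeriv N f x ≠ 0) :
    (∀ x : ℝ, 0 < x → 0 < iteratedDeriv N f x) ∨ ∀ x : ℝ, 0 < x → iteratedDeriv N f x < 0 := by
  by_contra! h
  obtain ⟨⟨x, hx, hx'⟩, y, hy, hy'⟩ := h
  obtain ⟨z, hz, hz'⟩ := (isPreconnected_Ioi (a := (0 : ℝ))).intermediate_value hx hy
    (isJet_iteratedDeriv hf).2 ⟨hx', hy'⟩
  exact hf0 z hz hz'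

theorem exists_pos_representative {N : ℕ} {f : ℝ → ℝ}
    (hf : ContDiffOn ℝ (N : WithTop ℕ∞) f (Set.Ioi 0))
    (hf0 : ∀ x : ℝ, 0 < x → iteratedDeriv N f x ≠ 0) :
    ∃ F : ℝ → ℝ, (F = f ∨ F = -f) ∧ ContDiffOn ℝ (N : WithTop ℕ∞) F (Set.Ioi 0) ∧
      ∀ x : ℝ, 0 < x → 0 < iteratedDeriv N F x := by
  rcases exists_sign_of_iteratedDeriv_ne_zero hf hf0 with h | h
  · exact ⟨f, .inl rfl, hf, h⟩
  · refine ⟨-f, .inr rfl, hf.neg, fun x hx => ?_⟩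
    rw [iteratedDeriv_neg]
    exact neg_pos.2 (h x hx)

theorem existsUnique_isHermiteMeanPoint_of_ne_zero {f : ℝ → ℝ} {m₁ m₂ : ℕ} (hm : m₂ < m₁)
    (hf : ContDiffOn ℝ ((m₁ + m₂ + 2 : ℕ) : WithTop ℕ∞) f (Set.Ioi 0))
    (hf0 : ∀ x : ℝ, 0 < x → iteratedDeriv (m₁ + m₂ + 2) f x ≠ 0) {a b : ℝ} (ha : 0 < a)
    (hb : 0 < b) (hab : a ≠ b) : ∃! x, IsHermiteMeanPoint f m₁ m₂ a b x := by
  obtain ⟨F, hFf, hF, hF0⟩ := exists_pos_representative hf hf0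
  have key : ∃! x, IsHermiteMeanPoint F m₁ m₂ a b x := by
    rcases lt_or_gt_of_ne hab with h | h
    · exact existsUnique_isHermiteMeanPoint hm ha h (isJet_iteratedDeriv hF) hF0
    · simp only [isHermiteMeanPoint_comm (a := a)]
      exact existsUnique_isHermiteMeanPoint hm hb h (isJet_iteratedDeriv hF) hF0
  rcases hFf with rfl | rfl
  · exact key
  · simpa only [isHermiteMeanPoint_neg] using key

theorem IsHermiteMeanPoint.lt_of_strictMonoOn_div {f g : ℝ → ℝ} {m₁ m₂ : ℕ} (hm : m₂ < m₁)
    (hf : ContDiffOn ℝ ((m₁ + m₂ + 2 : ℕ) : WithTop ℕ∞) f (Set.Ioi 0))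
    (hg : ContDiffOn ℝ ((m₁ + m₂ + 2 : ℕ) : WithTop ℕ∞) g (Set.Ioi 0))
    (hf0 : ∀ x : ℝ, 0 < x → 0 < iteratedDeriv (m₁ + m₂ + 2) f x)
    (hg0 : ∀ x : ℝ, 0 < x → 0 < iteratedDeriv (m₁ + m₂ + 2) g x)
    (hfg : StrictMonoOn
      (fun x => iteratedDeriv (m₁ + m₂ + 2) f x / iteratedDeriv (m₁ + m₂ + 2) g x) (Set.Ioi 0))
    {a b : ℝ} (ha : 0 < a) (hb : 0 < b) (hab : a ≠ b) {x y : ℝ}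
    (hx : IsHermiteMeanPoint g m₁ m₂ a b x) (hy : IsHermiteMeanPoint f m₁ m₂ a b y) : x < y := by
  have hcross : ∀ x y : ℝ, 0 < x → x < y →
      iteratedDeriv (m₁ + m₂ + 2) f x * iteratedDeriv (m₁ + m₂ + 2) g y <
        iteratedDeriv (m₁ + m₂ + 2) f y * iteratedDeriv (m₁ + m₂ + 2) g x := fun x y hx hxy =>
    (div_lt_div_iff₀ (hg0 x hx) (hg0 y (hx.trans hxy))).1 (hfg hx (hx.trans hxy) hxy)
  have hf' := isJet_iteratedDeriv hf
  have hg' := isJet_iteratedDeriv hg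
  rcases lt_or_gt_of_ne hab with h | h
  · exact lt_of_cross_lt hm ha h hf' hg' hf0 hg0 hcross hx hy
  · exact lt_of_cross_lt hm hb h hf' hg' hf0 hg0 hcross (isHermiteMeanPoint_comm.1 hx)
      (isHermiteMeanPoint_comm.1 hy)

theorem strictMonoOn_neg_or_strictAntiOn_neg {s : Set ℝ} {r : ℝ → ℝ}
    (h : StrictMonoOn r s ∨ StrictAntiOn r s) :
    StrictMonoOn (fun x => -r x) s ∨ StrictAntiOn (fun x => -r x) s :=
  h.symm.imp (fun h => h.neg) fun h => h.neg

theorem theorem7 (m₁ m₂ : ℕ) (hm : m₂ < m₁) (f g : ℝ → ℝ)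
    (hf : ContDiffOn ℝ ((m₁ + m₂ + 2 : ℕ) : WithTop ℕ∞) f (Set.Ioi 0))
    (hg : ContDiffOn ℝ ((m₁ + m₂ + 2 : ℕ) : WithTop ℕ∞) g (Set.Ioi 0))
    (hf0 : ∀ x : ℝ, 0 < x → iteratedDeriv (m₁ + m₂ + 2) f x ≠ 0)
    (hg0 : ∀ x : ℝ, 0 < x → iteratedDeriv (m₁ + m₂ + 2) g x ≠ 0)
    (hφ : StrictMonoOn
        (fun x => iteratedDeriv (m₁ + m₂ + 2) f x / iteratedDeriv (m₁ + m₂ + 2) g x) (Set.Ioi 0) ∨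
      StrictAntiOn
        (fun x => iteratedDeriv (m₁ + m₂ + 2) f x / iteratedDeriv (m₁ + m₂ + 2) g x) (Set.Ioi 0)) :
    (∀ a b : ℝ, 0 < a → 0 < b → a ≠ b →
      (∃! x, IsHermiteMeanPoint f m₁ m₂ a b x) ∧ (∃! x, IsHermiteMeanPoint g m₁ m₂ a b x)) ∧
    ((∀ a b : ℝ, 0 < a → 0 < b → a ≠ b → hermiteMean f m₁ m₂ a b < hermiteMean g m₁ m₂ a b) ∨
      (∀ a b : ℝ, 0 < a → 0 < b → a ≠ b → hermiteMean g m₁ m₂ a b < hermiteMean f m₁ m₂ a b)) := by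
  have hmf := fun {a b : ℝ} (ha : 0 < a) (hb : 0 < b) (hab : a ≠ b) =>
    existsUnique_isHermiteMeanPoint_of_ne_zero hm hf hf0 ha hb hab
  have hmg := fun {a b : ℝ} (ha : 0 < a) (hb : 0 < b) (hab : a ≠ b) =>
    existsUnique_isHermiteMeanPoint_of_ne_zero hm hg hg0 ha hb hab
  refine ⟨fun a b ha hb hab => ⟨hmf ha hb hab, hmg ha hb hab⟩, ?_⟩
  obtain ⟨F, hFf, hF, hF0⟩ := exists_pos_representative hf hf0
  obtain ⟨G, hGg, hG, hG0⟩ := exists_pos_representative hg hg0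
  -- Changing one sign reverses the direction of monotonicity, so only the disjunction is preserved.
  -- The direction does not depend on `a` and `b`, hence neither does the order of the means.
  have hφ' : StrictMonoOn
        (fun x => iteratedDeriv (m₁ + m₂ + 2) F x / iteratedDeriv (m₁ + m₂ + 2) G x) (Set.Ioi 0) ∨
      StrictAntiOn
        (fun x => iteratedDeriv (m₁ + m₂ + 2) F x / iteratedDeriv (m₁ + m₂ + 2) G x)
          (Set.Ioi 0) := by
    rcases hFf with rfl | rfl <;> rcases hGg with rfl | rfl
    · exact hφ
    · simpa only [iteratedDeriv_neg, div_neg] using strictMonoOn_neg_or_strictAntiOn_neg hφ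
    · simpa only [iteratedDeriv_neg, neg_div] using strictMonoOn_neg_or_strictAntiOn_neg hφ
    · simpa only [iteratedDeriv_neg, neg_div_neg_eq] using hφ
  have hpf : ∀ {a b : ℝ}, 0 < a → 0 < b → a ≠ b →
      IsHermiteMeanPoint F m₁ m₂ a b (hermiteMean f m₁ m₂ a b) := by
    intro a b ha hb hab
    have := isHermiteMeanPoint_hermiteMean (hmf ha hb hab)
    rcases hFf with rfl | rfl
    · exact this
    · exact isHermiteMeanPoint_neg.2 this
  have hpg : ∀ {a b : ℝ}, 0 < a → 0 < b → a ≠ b →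
      IsHermiteMeanPoint G m₁ m₂ a b (hermiteMean g m₁ m₂ a b) := by
    intro a b ha hb hab
    have := isHermiteMeanPoint_hermiteMean (hmg ha hb hab)
    rcases hGg with rfl | rfl
    · exact this
    · exact isHermiteMeanPoint_neg.2 this
  rcases hφ' with h | h
  · exact .inr fun a b ha hb hab => IsHermiteMeanPoint.lt_of_strictMonoOn_div hm hF hG hF0 hG0 h
      ha hb hab (hpg ha hb hab) (hpf ha hb hab)
  · refine .inl fun a b ha hb hab => IsHermiteMeanPoint.lt_of_strictMonoOn_div hm hG hF hG0 hF0 ?_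
      ha hb hab (hpf ha hb hab) (hpg ha hb hab)
    -- Since both top derivatives are positive, the reciprocal ratio is strictly increasing.
    intro x hx y hy hxy
    have := h hx hy hxy
    simp only at this ⊢
    rw [div_lt_div_iff₀ (hG0 y hy) (hG0 x hx)] at this
    rw [div_lt_div_iff₀ (hF0 x hx) (hF0 y hy)]
    linarith
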